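/- Let $d\in\{1,2,3\}$ and let $D\subseteq\mathbb{R}^d$ be an open and bounded set of class $S$, i.e. there are $\gamma\in(0,1)$ and $r_0>0$ such that $\mathrm{meas}(B_r(x)\setminus D)\ge\gamma\,\mathrm{meas}(B_r(x))$ for all $x\in\partial D$ and all $0<r<r_0$. Let $f_0,\phi_1,\dots,\phi_m\in L^2(D)$, $f(x,z):=f_0(x)+\sum_{i=1}^m z_i\phi_i(x)$ for $z\in\mathbb{R}^m$, and $\alpha\in\mathbb{R}$. Let $\xi$ be an $m$-dimensional random vector on a probability space $(\Omega,\mathcal{F},\mathbb{P})$ whose law is a Gaussian distribution $\mathcal{N}(\mu,\Sigma)$ truncated to (conditioned on) a compact convex set $\Xi\subseteq\mathbb{R}^m$ of positive $\mathcal{N}(\mu,\Sigma)$-measure. For $u\in L^2(D)$ and $\omega\in\Omega$ let $y(\cdot,\omega)\in H_0^1(D)$ be the weak solution of $-\Delta y(x,\omega)=u(x)+f(x,\xi(\omega))$ for $x\in D$, $y(x,\omega)=0$ for $x\in\partial D$ (identified with its continuous version). Let $F\colon L^2(D)\to\mathbb{R}$ be convex and Fréchet differentiable, and for $p\in(0,1]$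 consider the problem $$(P_p)\qquad \min_{u\in L^2(D)}F(u)\quad\text{s.t.}\quad \mathbb{P}\bigl(y(x,\omega)\le\alpha\ \ \forall x\in D\bigr)\ge p .$$ Assume that $F$ is strictly convex. Let $p_k\in(0,1)$ with $p_k\to1$, and let $(u_{p_k})_{k\in\mathbb{N}}$ be a bounded sequence in $L^2(D)$ such that $u_{p_k}$ is a minimizer of $(P_{p_k})$ for every $k$. Then $(P_1)$ has a unique solution $\bar u$, and $u_{p_k}\rightharpoonup\bar u$ weakly in $L^2(D)$. If, moreover, $F$ is strongly convex, then $u_{p_k}\to\bar u$ strongly in $L^2(D)$. -/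

import Mathlib

open MeasureTheory ProbabilityTheory Set Filter Topology
open scoped ContDiff

noncomputable section

/-- The Euclidean space `ℝⁿ`. -/
abbrev Eucl (n : ℕ) : Type := EuclideanSpace ℝ (Fin n)

/-- The Hilbert space `L²(D)` (Lebesgue measure on `D`). -/
abbrev L2 {d : ℕ} (D : Set (Eucl d)) : Type := Lp ℝ 2 (volume.restrict D)

/-- Domains of class `S`: there are `γ ∈ (0,1)` and `r₀ > 0` such that
`meas (B_r(x) \ D) ≥ γ * meas (B_r(x))` for all `x ∈ ∂D` and all `r < r₀`. -/
def IsClassS {d : ℕ} (D : Set (Eucl d)) : Prop :=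
  ∃ γ : ℝ, 0 < γ ∧ γ < 1 ∧ ∃ r₀ : ℝ, 0 < r₀ ∧ ∀ x ∈ frontier D, ∀ r : ℝ, 0 < r → r < r₀ →
    ENNReal.ofReal γ * volume (Metric.ball x r) ≤ volume (Metric.ball x r \ D)

/-- Test functions on `D`: smooth functions whose support is compact and contained in `D`. -/
def IsTestFunction {d : ℕ} (D : Set (Eucl d)) (φ : Eucl d → ℝ) : Prop :=
  ContDiff ℝ ∞ φ ∧ HasCompactSupport φ ∧ tsupport φ ⊆ D

/-- `y ∈ H¹₀(D)` with weak gradient `G`: `(y, G)` is the limit in `L²(D) × L²(D; ℝᵈ)` of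
`(φ n, ∇ φ n)` for test functions `φ n`, i.e. `y` lies in the `H¹`-closure of `C_c^∞(D)`. -/
def HasH10Gradient {d : ℕ} (D : Set (Eucl d)) (y : L2 D)
    (G : Lp (Eucl d) 2 (volume.restrict D)) : Prop :=
  ∃ φ : ℕ → Eucl d → ℝ, (∀ n, IsTestFunction D (φ n)) ∧
    Tendsto (fun n => eLpNorm (fun x => φ n x - y x) 2 (volume.restrict D)) atTop (𝓝 0) ∧
    Tendsto (fun n => eLpNorm (fun x => gradient (φ n) x - G x) 2 (volume.restrict D))
      atTop (𝓝 0)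

/-- `y` is the weak solution in `H¹₀(D)` of `-Δ y = h` in `D`, `y = 0` on `∂D`. -/
def IsPoissonSolution {d : ℕ} (D : Set (Eucl d)) (h y : L2 D) : Prop :=
  ∃ G : Lp (Eucl d) 2 (volume.restrict D), HasH10Gradient D y G ∧
    ∀ φ : Eucl d → ℝ, IsTestFunction D φ →
      ∫ x in D, inner ℝ (G x) (gradient φ x) = ∫ x in D, h x * φ x

/-- The value at the point `x` of a function given only up to null sets: the (upper) limit of its
means over small balls centred at `x`. Wherever the function has a continuous version, this is the
value of that version, see `pointValue_eq_of_continuousOn`. -/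
def pointValue {d : ℕ} (y : Eucl d → ℝ) (x : Eucl d) : EReal :=
  limsup (fun r : ℝ => ((⨍ t in Metric.ball x r, y t : ℝ) : EReal)) (𝓝[>] 0)

/-- If `y` agrees almost everywhere on the open set `D` with a function `v` that is continuous
on `D`, then the point values of `y` on `D` are those of `v`. -/
theorem pointValue_eq_of_continuousOn {d : ℕ} {D : Set (Eucl d)} (hD : IsOpen D)
    {y v : Eucl d → ℝ} (hv : ContinuousOn v D) (hyv : y =ᵐ[volume.restrict D] v)
    {x : Eucl d} (hx : x ∈ D) : pointValue y x = (v x : EReal) := by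
  have key : Tendsto (fun r : ℝ => ⨍ t in Metric.ball x r, y t) (𝓝[>] 0) (𝓝 (v x)) := by
    rw [Metric.tendsto_nhds]
    intro ε hε
    have hc : ContinuousAt v x := hv.continuousAt (hD.mem_nhds hx)
    have hmem : {t | v t ∈ Metric.closedBall (v x) (ε / 2)} ∩ D ∈ 𝓝 x :=
      inter_mem (hc (Metric.closedBall_mem_nhds _ (by positivity))) (hD.mem_nhds hx)
    obtain ⟨δ, hδ, hball⟩ := Metric.mem_nhds_iff.1 hmem
    filter_upwards [Ioo_mem_nhdsGT hδ] with r hr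
    have hsub : Metric.ball x r ⊆ {t | v t ∈ Metric.closedBall (v x) (ε / 2)} ∩ D :=
      (Metric.ball_subset_ball hr.2.le).trans hball
    have hae : ∀ᵐ t ∂volume.restrict (Metric.ball x r),
        y t ∈ Metric.closedBall (v x) (ε / 2) := by
      have h1 := ae_restrict_of_ae_restrict_of_subset (fun t ht => (hsub ht).2) hyv
      filter_upwards [h1, ae_restrict_mem Metric.isOpen_ball.measurableSet] with t h1 ht
      rw [h1]
      exact (hsub ht).1
    have hyae : AEStronglyMeasurable y (volume.restrict (Metric.ball x r)) := by
      have h2 : AEStronglyMeasurable v (volume.restrict D) :=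
        hv.aestronglyMeasurable hD.measurableSet
      exact (h2.congr hyv.symm).mono_measure
        (Measure.restrict_mono (fun t ht => (hsub ht).2) le_rfl)
    have hfin : volume (Metric.ball x r) ≠ ⊤ := Metric.isBounded_ball.measure_lt_top.ne
    have hint : IntegrableOn y (Metric.ball x r) := by
      have : IsFiniteMeasure (volume.restrict (Metric.ball x r)) :=
        ⟨by simpa using hfin.lt_top⟩
      refine Integrable.of_bound hyae (|v x| + ε / 2) ?_
      filter_upwards [hae] with t ht
      have h3 : |y t - v x| ≤ ε / 2 := by simpa [Real.dist_eq] using ht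
      have h4 : |y t| ≤ |y t - v x| + |v x| := by
        simpa using abs_add_le (y t - v x) (v x)
      rw [Real.norm_eq_abs]
      linarith
    have hmean := (convex_closedBall (v x) (ε / 2)).set_average_mem Metric.isClosed_closedBall
      (Metric.measure_ball_pos volume x hr.1).ne' hfin hae hint
    have := Metric.mem_closedBall.1 hmean
    linarith
  exact ((continuous_coe_real_ereal.tendsto (v x)).comp key).limsup_eq

/-- The random source term `f(x, z) = f₀(x) + ∑ i, z i * φ i (x)` at `z`, as an element of
`L²(D)`. -/
def source {d m : ℕ} {D : Set (Eucl d)} (f₀ : L2 D) (φ : Fin m → L2 D) (z : Eucl m) : L2 D :=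
  f₀ + ∑ i, z i • φ i

/-- The state generated by the control `u` and the realization `z` of the random vector, i.e. the
solution `y` of `-Δ y = u + f(·, z)` in `D`, `y = 0` on `∂D`, satisfies `y(x) ≤ α` for all
`x ∈ D`. -/
def StateBelow {d m : ℕ} (D : Set (Eucl d)) (f₀ : L2 D) (φ : Fin m → L2 D) (α : ℝ)
    (u : L2 D) (z : Eucl m) : Prop :=
  ∃ y : L2 D, IsPoissonSolution D (u + source f₀ φ z) y ∧ ∀ x ∈ D, pointValue y x ≤ (α : EReal)

/-- The control `u` satisfies the probabilistic state constraint
`ℙ (w | y(x, w) ≤ α for all x ∈ D) ≥ p`. -/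
def IsFeasible {d m : ℕ} (D : Set (Eucl d)) (f₀ : L2 D) (φ : Fin m → L2 D) (α : ℝ)
    {Ω : Type*} [MeasurableSpace Ω] (P : Measure Ω) (ξ : Ω → Eucl m) (p : ℝ) (u : L2 D) : Prop :=
  p ≤ P.real {w | StateBelow D f₀ φ α u (ξ w)}

/-- The control `u` is an optimal solution (minimizer) of the problem with probability level `p`:
minimize `F` over all controls satisfying the probabilistic state constraint. -/
def IsOptimal {d m : ℕ} (D : Set (Eucl d)) (F : L2 D → ℝ) (f₀ : L2 D) (φ : Fin m → L2 D) (α : ℝ)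
    {Ω : Type*} [MeasurableSpace Ω] (P : Measure Ω) (ξ : Ω → Eucl m) (p : ℝ) (u : L2 D) : Prop :=
  IsFeasible D f₀ φ α P ξ p u ∧ ∀ v : L2 D, IsFeasible D f₀ φ α P ξ p v → F u ≤ F v

/-- The Gaussian distribution `𝒩(μ, S)` on `ℝᵐ` truncated to `Ξ`, i.e. conditioned on `Ξ`. -/
def truncatedGaussian {m : ℕ} (μ : Eucl m) (S : Matrix (Fin m) (Fin m) ℝ) (Ξ : Set (Eucl m)) :
    Measure (Eucl m) :=
  ProbabilityTheory.cond (multivariateGaussian μ S) Ξ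

end

section Convex

variable {E : Type*}

/-- A uniformly convex function lies above its tangents, with the modulus as a gap. -/
theorem UniformConvexOn.add_fderiv_add_le [NormedAddCommGroup E] [NormedSpace ℝ E]
    {F : E → ℝ} {ψ : ℝ → ℝ} (hF : UniformConvexOn univ ψ F) {F' : E →L[ℝ] ℝ} {a : E}
    (hd : HasFDerivAt F F' a) (b : E) : F a + F' (b - a) + ψ ‖a - b‖ ≤ F b := by
  have hline : HasDerivAt (fun t : ℝ => F (a + t • (b - a))) (F' (b - a)) 0 := by
    have h1 : HasDerivAt (fun t : ℝ => a + t • (b - a)) (b - a) 0 := by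
      simpa using ((hasDerivAt_id (0 : ℝ)).smul_const (b - a)).const_add a
    have h2 : HasFDerivAt F F' (a + (0 : ℝ) • (b - a)) := by simpa using hd
    exact h2.comp_hasDerivAt 0 h1
  have hslope : Tendsto (fun t : ℝ => t⁻¹ * (F (a + t • (b - a)) - F a)) (𝓝[>] 0)
      (𝓝 (F' (b - a))) := by
    have := (hasDerivAt_iff_tendsto_slope_zero.1 hline).mono_left
      (nhdsWithin_mono 0 (fun t (ht : t ∈ Ioi 0) => (mem_Ioi.1 ht).ne'))
    simpa using this
  have hbound : Tendsto (fun t : ℝ => F b - F a - (1 - t) * ψ ‖a - b‖) (𝓝[>] 0)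
      (𝓝 (F b - F a - (1 - 0) * ψ ‖a - b‖)) :=
    (Continuous.tendsto (by fun_prop) 0).mono_left nhdsWithin_le_nhds
  have hle := le_of_tendsto_of_tendsto hslope hbound <| by
    filter_upwards [Ioo_mem_nhdsGT (zero_lt_one' ℝ)] with t ht
    have h := hF.2 (mem_univ a) (mem_univ b) (sub_nonneg.2 ht.2.le) ht.1.le (by ring)
    have hab : (1 - t) • a + t • b = a + t • (b - a) := by module
    rw [hab, smul_eq_mul, smul_eq_mul] at h
    rw [inv_mul_le_iff₀ ht.1]
    linarith
  linarith

end Convex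

section Weak

variable {E : Type*} [NormedAddCommGroup E] [InnerProductSpace ℝ E]

/-- Closed balls of a Hilbert space are weakly compact. -/
theorem isCompact_toWeakSpace_image_closedBall [CompleteSpace E] (r : ℝ) :
    IsCompact (toWeakSpace ℝ E '' Metric.closedBall 0 r) := by
  let g : WeakDual ℝ E → WeakSpace ℝ E := fun f =>
    toWeakSpace ℝ E ((InnerProductSpace.toDual ℝ E).symm (WeakDual.toStrongDual f))
  have hg : Continuous g := by
    refine WeakBilin.continuous_of_continuous_eval _ fun ℓ => ?_
    have : (fun f => (topDualPairing ℝ E).flip (g f) ℓ) = fun f : WeakDual ℝ E =>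
        f ((InnerProductSpace.toDual ℝ E).symm ℓ) := by
      ext f
      have h1 : (topDualPairing ℝ E).flip (g f) ℓ
          = ℓ ((InnerProductSpace.toDual ℝ E).symm (WeakDual.toStrongDual f)) := rfl
      rw [h1, ← InnerProductSpace.toDual_symm_apply (𝕜 := ℝ), real_inner_comm,
        InnerProductSpace.toDual_symm_apply]
      rfl
    exact this ▸ WeakDual.eval_continuous _
  have himg := (WeakDual.isCompact_closedBall (𝕜 := ℝ) (0 : StrongDual ℝ E) r).image hg
  refine himg.of_isClosed_subset ?_ ?_
  · have h1 := (convex_closedBall (0 : E) r).toWeakSpace_closure ℝ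
    rw [Metric.isClosed_closedBall.closure_eq] at h1
    rw [h1]
    exact isClosed_closure
  · rintro _ ⟨x, hx, rfl⟩
    refine ⟨StrongDual.toWeakDual (InnerProductSpace.toDual ℝ E x), ?_, ?_⟩
    · simpa using hx
    · simp [g]

/-- Closed convex sets contain the weak limits of their points. -/
theorem Convex.mem_of_tendsto_toWeakSpace {C : Set E} (hC : Convex ℝ C) (hcl : IsClosed C)
    {ι : Type*} {l : Filter ι} [l.NeBot] {u : ι → E} {a : E}
    (hu : Tendsto (fun k => toWeakSpace ℝ E (u k)) l (𝓝 (toWeakSpace ℝ E a)))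
    (hmem : ∀ᶠ k in l, u k ∈ C) : a ∈ C := by
  have h1 := hC.toWeakSpace_closure ℝ
  rw [hcl.closure_eq] at h1
  have h2 : toWeakSpace ℝ E a ∈ toWeakSpace ℝ E '' C := by
    rw [h1]
    exact mem_closure_of_tendsto hu (hmem.mono fun k hk => mem_image_of_mem _ hk)
  obtain ⟨b, hb, hab⟩ := h2
  exact (toWeakSpace ℝ E).injective hab ▸ hb

theorem tendsto_dual_of_tendsto_toWeakSpace {ι : Type*} {l : Filter ι} {u : ι → E} {a : E}
    (hu : Tendsto (fun k => toWeakSpace ℝ E (u k)) l (𝓝 (toWeakSpace ℝ E a)))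
    (f : E →L[ℝ] ℝ) : Tendsto (fun k => f (u k)) l (𝓝 (f a)) :=
  ((WeakBilin.eval_continuous (topDualPairing ℝ E).flip f).tendsto _).comp hu

/-- A bounded sequence converges weakly to `a` if every subsequence has a further subsequence
whose weak limits along ultrafilters all equal `a`. -/
theorem tendsto_toWeakSpace_of_subseq [CompleteSpace E] {u : ℕ → E}
    (hu : Bornology.IsBounded (range u)) {a : E}
    (h : ∀ ns : ℕ → ℕ, Tendsto ns atTop atTop → ∃ ms : ℕ → ℕ,
      ∀ (U : Ultrafilter ℕ) (b : E), ↑U ≤ (atTop : Filter ℕ) →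
        Tendsto (fun n => toWeakSpace ℝ E (u (ns (ms n)))) U (𝓝 (toWeakSpace ℝ E b)) → b = a) :
    Tendsto (fun k => toWeakSpace ℝ E (u k)) atTop (𝓝 (toWeakSpace ℝ E a)) := by
  obtain ⟨r, hr⟩ := hu.subset_closedBall 0
  refine tendsto_of_subseq_tendsto fun ns hns => ?_
  obtain ⟨ms, hms⟩ := h ns hns
  refine ⟨ms, (isCompact_toWeakSpace_image_closedBall (E := E)
    r).tendsto_nhds_of_unique_mapClusterPt
    (.of_forall fun n => mem_image_of_mem _ (hr (mem_range_self _))) ?_⟩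
  rintro _ ⟨b, -, rfl⟩ hb
  obtain ⟨U, hU, hUb⟩ := mapClusterPt_iff_ultrafilter.1 hb
  rw [hms U b hU hUb]

/-- Along every ultrafilter a bounded sequence in a Hilbert space converges weakly. -/
theorem exists_tendsto_toWeakSpace_ultrafilter [CompleteSpace E] {u : ℕ → E}
    (hu : Bornology.IsBounded (range u)) (U : Ultrafilter ℕ) :
    ∃ b : E, Tendsto (fun n => toWeakSpace ℝ E (u n)) U (𝓝 (toWeakSpace ℝ E b)) := by
  obtain ⟨r, hr⟩ := hu.subset_closedBall 0
  obtain ⟨_, ⟨b, -, rfl⟩, hb⟩ := (isCompact_toWeakSpace_image_closedBall (E := E)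
    r).ultrafilter_le_nhds (U.map fun n => toWeakSpace ℝ E (u n))
    (tendsto_principal.2 (.of_forall fun n => mem_image_of_mem _ (hr (mem_range_self n))))
  exact ⟨b, hb⟩

end Weak

section WeakSolutions

variable {E H : Type*} [NormedAddCommGroup E] [InnerProductSpace ℝ E]
  [NormedAddCommGroup H] [InnerProductSpace ℝ H]

/-- The triples `(h, y, G)` with `(y, G) ∈ V` and `⟪G, K⟫ = ⟪h, w⟫` for all `(w, K) ∈ V`: the
abstract form of the weak formulation of `-Δ y = h`, `G` being the gradient of `y`. -/
def weakSolutions (V : Submodule ℝ (E × H)) : Submodule ℝ (E × E × H) where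
  carrier := {s | s.2 ∈ V ∧ ∀ w ∈ V, inner ℝ s.2.2 w.2 = inner ℝ s.1 w.1}
  add_mem' := by
    rintro s t ⟨hs, hs'⟩ ⟨ht, ht'⟩
    refine ⟨V.add_mem hs ht, fun w hw => ?_⟩
    simp [inner_add_left, hs' w hw, ht' w hw]
  zero_mem' := ⟨V.zero_mem, fun w _ => by simp⟩
  smul_mem' := by
    rintro c s ⟨hs, hs'⟩
    refine ⟨V.smul_mem c hs, fun w hw => ?_⟩
    simp [inner_smul_left, hs' w hw]

theorem isClosed_weakSolutions {V : Submodule ℝ (E × H)} (hV : IsClosed (V : Set (E × H))) :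
    IsClosed (weakSolutions V : Set (E × E × H)) := by
  have : (weakSolutions V : Set (E × E × H)) = (fun s => s.2) ⁻¹' (V : Set (E × H)) ∩
      ⋂ w ∈ V, {s | inner ℝ s.2.2 w.2 = inner ℝ s.1 w.1} := by
    ext s
    simp [weakSolutions]
  rw [this]
  refine (hV.preimage continuous_snd).inter
    (isClosed_biInter fun w _ => isClosed_eq ?_ ?_) <;> fun_prop

/-- Under a Poincaré inequality the right hand sides of the weak formulation whose solution lies in
a closed set form a closed set. -/
theorem isClosed_rhs_weakSolutions [CompleteSpace E] [CompleteSpace H] {V : Submodule ℝ (E × H)}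
    (hV : IsClosed (V : Set (E × H))) {K : ℝ} (hK : 0 ≤ K) (hP : ∀ w ∈ V, ‖w.1‖ ≤ K * ‖w.2‖)
    {A : Set E} (hA : IsClosed A) :
    IsClosed {h : E | ∃ y ∈ A, ∃ G : H, (h, y, G) ∈ weakSolutions V} := by
  have hS := isClosed_weakSolutions hV
  have : CompleteSpace (weakSolutions V) := hS.completeSpace_coe
  let L : weakSolutions V →L[ℝ] E :=
    (ContinuousLinearMap.fst ℝ E (E × H)).comp (weakSolutions V).subtypeL
  have hL : AntilipschitzWith (1 + K + K * K).toNNReal L := by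
    refine L.antilipschitz_of_bound ?_
    rintro ⟨⟨h, y, G⟩, hy, hw⟩
    have hyG : ‖y‖ ≤ K * ‖G‖ := hP _ hy
    have hG : ‖G‖ ≤ K * ‖h‖ := by
      have h1 : inner ℝ G G = inner ℝ h y := hw _ hy
      rw [real_inner_self_eq_norm_sq] at h1
      have h2 := real_inner_le_norm h y
      have h3 : ‖G‖ * ‖G‖ ≤ (K * ‖h‖) * ‖G‖ := by
        nlinarith [mul_le_mul_of_nonneg_left hyG (norm_nonneg h)]
      rcases (norm_nonneg G).eq_or_lt with h0 | h0
      · rw [← h0]; positivity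
      · exact le_of_mul_le_mul_right h3 h0
    rw [Real.coe_toNNReal _ (by positivity)]
    change max ‖h‖ (max ‖y‖ ‖G‖) ≤ (1 + K + K * K) * ‖h‖
    have h4 : K * ‖G‖ ≤ K * (K * ‖h‖) := by gcongr
    have h5 : 0 ≤ K * ‖h‖ := by positivity
    have h6 : 0 ≤ K * (K * ‖h‖) := by positivity
    have h7 := norm_nonneg h
    refine max_le ?_ (max_le ?_ ?_) <;> linarith
  have himg := (hL.isClosedEmbedding L.uniformContinuous).isClosedMap
    {s | s.1.2.1 ∈ A} (hA.preimage (by fun_prop))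
  convert himg using 1
  ext h
  constructor
  · rintro ⟨y, hy, G, hG⟩
    exact ⟨⟨(h, y, G), hG⟩, hy, rfl⟩
  · rintro ⟨⟨⟨h, y, G⟩, hG⟩, hy, rfl⟩
    exact ⟨y, hy, G, hG⟩

theorem convex_rhs_weakSolutions (V : Submodule ℝ (E × H)) {A : Set E} (hA : Convex ℝ A) :
    Convex ℝ {h : E | ∃ y ∈ A, ∃ G : H, (h, y, G) ∈ weakSolutions V} := by
  rintro h ⟨y, hy, G, hG⟩ h' ⟨y', hy', G', hG'⟩ a b ha hb hab
  exact ⟨_, hA hy hy' ha hb hab, _,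
    (weakSolutions V).add_mem ((weakSolutions V).smul_mem a hG) ((weakSolutions V).smul_mem b hG')⟩

end WeakSolutions

section Poincare

variable {d : ℕ} {D : Set (Eucl d)} {φ : Eucl d → ℝ}

theorem IsTestFunction.continuous_gradient (h : IsTestFunction D φ) :
    Continuous (gradient φ) :=
  (InnerProductSpace.toDual ℝ (Eucl d)).symm.continuous.comp
    (h.1.continuous_fderiv (by simp))

theorem IsTestFunction.hasCompactSupport_gradient (h : IsTestFunction D φ) :
    HasCompactSupport (gradient φ) :=
  (h.2.1.fderiv (𝕜 := ℝ)).comp_left (g := (InnerProductSpace.toDual ℝ (Eucl d)).symm) (map_zero _)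

theorem IsTestFunction.memLp (h : IsTestFunction D φ) : MemLp φ 2 (volume.restrict D) :=
  (h.1.continuous.memLp_of_hasCompactSupport h.2.1).restrict D

theorem IsTestFunction.memLp_gradient (h : IsTestFunction D φ) :
    MemLp (gradient φ) 2 (volume.restrict D) :=
  (h.continuous_gradient.memLp_of_hasCompactSupport h.hasCompactSupport_gradient).restrict D

theorem IsTestFunction.differentiable (h : IsTestFunction D φ) : Differentiable ℝ φ :=
  h.1.differentiable (by simp)

theorem IsTestFunction.gradient_add {ψ : Eucl d → ℝ} (h : IsTestFunction D φ)
    (h' : IsTestFunction D ψ) : gradient (φ + ψ) = gradient φ + gradient ψ := by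
  ext1 x
  simp [gradient, fderiv_add (h.differentiable x) (h'.differentiable x)]

theorem IsTestFunction.gradient_smul (h : IsTestFunction D φ) (c : ℝ) :
    gradient (c • φ) = c • gradient φ := by
  ext1 x
  simp [gradient, fderiv_const_smul (h.differentiable x)]

theorem IsTestFunction.add {ψ : Eucl d → ℝ} (h : IsTestFunction D φ)
    (h' : IsTestFunction D ψ) : IsTestFunction D (φ + ψ) :=
  ⟨h.1.add h'.1, h.2.1.add h'.2.1, (tsupport_add φ ψ).trans (union_subset h.2.2 h'.2.2)⟩

theorem IsTestFunction.smul (h : IsTestFunction D φ) (c : ℝ) : IsTestFunction D (c • φ) :=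
  ⟨h.1.const_smul c, h.2.1.smul_left (f := fun _ => c),
    (tsupport_smul_subset_right (fun _ => c) φ).trans h.2.2⟩

theorem isTestFunction_zero : IsTestFunction D (0 : Eucl d → ℝ) :=
  ⟨contDiff_const, HasCompactSupport.zero, by simp [tsupport]⟩

/-- **Poincaré inequality** for test functions on a set contained in a ball of radius `R`. -/
theorem IsTestFunction.integral_sq_le (hd : 1 ≤ d) (h : IsTestFunction D φ) {R : ℝ}
    (hR : D ⊆ Metric.closedBall 0 R) :
    ∫ x, φ x ^ 2 ≤ 4 * R ^ 2 * ∫ x, ‖gradient φ x‖ ^ 2 := by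
  obtain ⟨g, e, he, hge, hgle⟩ : ∃ (g : Eucl d →L[ℝ] ℝ) (e : Eucl d), ‖e‖ = 1 ∧ g e = 1 ∧
      ∀ x, |g x| ≤ ‖x‖ :=
    ⟨EuclideanSpace.proj ⟨0, hd⟩, EuclideanSpace.single ⟨0, hd⟩ 1, by simp, by simp,
      fun x => PiLp.norm_apply_le x _⟩
  have hc := h.1.continuous
  have hc' : Continuous (fderiv ℝ φ) := h.1.continuous_fderiv (by simp)
  have hdφ : ∀ x, fderiv ℝ φ x e = inner ℝ (gradient φ x) e := fun x => by
    simp [gradient, InnerProductSpace.toDual_symm_apply]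
  have hder : ∀ x, fderiv ℝ (fun x => φ x ^ 2) x e = 2 * φ x * fderiv ℝ φ x e := fun x => by
    have := ((h.differentiable x).hasFDerivAt.pow 2).fderiv
    rw [this]
    simp
  have hsupp : HasCompactSupport (fun x => φ x ^ 2) :=
    h.2.1.comp_left (g := fun t : ℝ => t ^ 2) (by simp)
  have hsupp2 : HasCompactSupport (fun x => 2 * φ x * fderiv ℝ φ x e * g x) :=
    h.2.1.mono fun x hx hφx => hx (by simp [hφx])
  have hsupp3 : HasCompactSupport (fun x => φ x ^ 2 * g x) :=
    h.2.1.mono fun x hx hφx => hx (by simp [hφx])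
  have hsupp4 : HasCompactSupport (fun x => ‖gradient φ x‖ ^ 2) :=
    h.hasCompactSupport_gradient.mono fun x hx hφx => hx (by simp [hφx])
  have hc4 : Continuous (fun x => ‖gradient φ x‖ ^ 2) := h.continuous_gradient.norm.pow 2
  have hi1 : Integrable (fun x => φ x ^ 2) :=
    (hc.pow 2).integrable_of_hasCompactSupport hsupp
  have hi2 : Integrable (fun x => 2 * φ x * fderiv ℝ φ x e * g x) :=
    Continuous.integrable_of_hasCompactSupport (by fun_prop) hsupp2
  have hi3 : Integrable (fun x => φ x ^ 2 * g x) :=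
    Continuous.integrable_of_hasCompactSupport (by fun_prop) hsupp3
  have hi4 : Integrable (fun x => ‖gradient φ x‖ ^ 2) :=
    hc4.integrable_of_hasCompactSupport hsupp4
  have hparts := integral_mul_fderiv_eq_neg_fderiv_mul_of_integrable (μ := volume)
    (f := fun x => φ x ^ 2) (g := g) (v := e) (by simpa only [hder] using hi2)
    (by simpa [hge] using hi1) hi3 (fun x _ => (h.differentiable x).pow 2)
    (fun x _ => g.differentiableAt)
  simp only [hder, ContinuousLinearMap.fderiv, hge, mul_one] at hparts
  have hpt : ∀ x, -(2 * φ x * fderiv ℝ φ x e * g x)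
      ≤ 2⁻¹ * φ x ^ 2 + 2 * R ^ 2 * ‖gradient φ x‖ ^ 2 := fun x => by
    by_cases hx : x ∈ D
    · have hgx : |g x| ≤ R := (hgle x).trans (mem_closedBall_zero_iff.1 (hR hx))
      have hfx : |fderiv ℝ φ x e| ≤ ‖gradient φ x‖ := by
        rw [hdφ]
        simpa [he] using abs_real_inner_le_norm (gradient φ x) e
      have hq : |fderiv ℝ φ x e * g x| ≤ R * ‖gradient φ x‖ := by
        rw [abs_mul, mul_comm R]
        gcongr
      have hq2 : (fderiv ℝ φ x e * g x) ^ 2 ≤ (R * ‖gradient φ x‖) ^ 2 := sq_le_sq'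
        (by linarith [neg_abs_le (fderiv ℝ φ x e * g x)]) ((le_abs_self _).trans hq)
      nlinarith [sq_nonneg (φ x + 2 * (fderiv ℝ φ x e * g x))]
    · have : φ x = 0 := image_eq_zero_of_notMem_tsupport fun hx' => hx (h.2.2 hx')
      simp only [this]
      simp
      positivity
  have hle := integral_mono hi2.neg ((hi1.const_mul 2⁻¹).add (hi4.const_mul (2 * R ^ 2))) hpt
  simp only [Pi.neg_apply, Pi.add_apply] at hle
  rw [integral_add (hi1.const_mul _) (hi4.const_mul _), integral_const_mul, integral_const_mul,
    integral_neg] at hle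
  linarith

/-- The pairs `(φ, ∇ φ)` of a test function and its gradient. -/
def testPairs (D : Set (Eucl d)) :
    Submodule ℝ (L2 D × Lp (Eucl d) 2 (volume.restrict D)) where
  carrier := {w | ∃ φ : Eucl d → ℝ, ∃ h : IsTestFunction D φ,
    w = (h.memLp.toLp φ, h.memLp_gradient.toLp (gradient φ))}
  add_mem' := by
    rintro _ _ ⟨φ, h, rfl⟩ ⟨ψ, h', rfl⟩
    refine ⟨φ + ψ, h.add h', Prod.ext (MemLp.toLp_add h.memLp h'.memLp).symm ?_⟩
    simp only [h.gradient_add h']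
    exact (MemLp.toLp_add h.memLp_gradient h'.memLp_gradient).symm
  zero_mem' := by
    refine ⟨0, isTestFunction_zero, Prod.ext (MemLp.toLp_zero isTestFunction_zero.memLp).symm ?_⟩
    have : gradient (0 : Eucl d → ℝ) = 0 := by
      ext1 x
      simp [gradient]
    simp only [this]
    exact (MemLp.toLp_zero _).symm
  smul_mem' := by
    rintro c _ ⟨φ, h, rfl⟩
    refine ⟨c • φ, h.smul c, Prod.ext (MemLp.toLp_const_smul c h.memLp).symm ?_⟩
    simp only [h.gradient_smul c]
    exact (MemLp.toLp_const_smul c h.memLp_gradient).symm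

theorem hasH10Gradient_iff {y : L2 D} {G : Lp (Eucl d) 2 (volume.restrict D)} :
    HasH10Gradient D y G ↔ (y, G) ∈ (testPairs D).topologicalClosure := by
  rw [← SetLike.mem_coe, Submodule.topologicalClosure_coe, mem_closure_iff_seq_limit]
  have key : ∀ (φ : ℕ → Eucl d → ℝ) (h : ∀ n, IsTestFunction D (φ n)),
      (Tendsto (fun n => eLpNorm (fun x => φ n x - y x) 2 (volume.restrict D)) atTop (𝓝 0) ∧
      Tendsto (fun n => eLpNorm (fun x => gradient (φ n) x - G x) 2 (volume.restrict D))
        atTop (𝓝 0)) ↔ Tendsto (fun n => ((h n).memLp.toLp (φ n),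
          (h n).memLp_gradient.toLp (gradient (φ n)))) atTop (𝓝 (y, G)) := by
    intro φ h
    rw [Prod.tendsto_iff]
    have h1 := Lp.tendsto_Lp_iff_tendsto_eLpNorm'' (fi := atTop) φ (fun n => (h n).memLp) y
      (Lp.memLp y)
    have h2 := Lp.tendsto_Lp_iff_tendsto_eLpNorm'' (fi := atTop) (fun n => gradient (φ n))
      (fun n => (h n).memLp_gradient) G (Lp.memLp G)
    rw [Lp.toLp_coeFn] at h1 h2
    exact and_congr h1.symm h2.symm
  constructor
  · rintro ⟨φ, h, hφ⟩
    exact ⟨_, fun n => ⟨φ n, h n, rfl⟩, (key φ h).1 hφ⟩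
  · rintro ⟨w, hw, hlim⟩
    choose φ h hwφ using hw
    obtain rfl : w = _ := funext hwφ
    exact ⟨φ, h, (key φ h).2 hlim⟩

theorem norm_fst_le_of_mem_testPairs (hd : 1 ≤ d) {R : ℝ} (hR0 : 0 ≤ R)
    (hR : D ⊆ Metric.closedBall 0 R) {w : L2 D × Lp (Eucl d) 2 (volume.restrict D)}
    (hw : w ∈ (testPairs D).topologicalClosure) : ‖w.1‖ ≤ 2 * R * ‖w.2‖ := by
  have hcl : IsClosed {w : L2 D × Lp (Eucl d) 2 (volume.restrict D) |
      ‖w.1‖ ≤ 2 * R * ‖w.2‖} := isClosed_le (by fun_prop) (by fun_prop)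
  refine closure_minimal ?_ hcl hw
  rintro _ ⟨φ, h, rfl⟩
  have hsq : ‖h.memLp.toLp φ‖ ^ 2 = ∫ x, φ x ^ 2 := by
    rw [← real_inner_self_eq_norm_sq, L2.inner_def,
      ← setIntegral_eq_integral_of_forall_compl_eq_zero (s := D) (f := fun x => φ x ^ 2)]
    · refine integral_congr_ae ?_
      filter_upwards [h.memLp.coeFn_toLp] with x hx
      rw [hx]
      simp [sq]
    · intro x hx
      rw [image_eq_zero_of_notMem_tsupport fun hx' => hx (h.2.2 hx')]
      simp
  have hsq' : ‖h.memLp_gradient.toLp (gradient φ)‖ ^ 2 = ∫ x, ‖gradient φ x‖ ^ 2 := by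
    rw [← real_inner_self_eq_norm_sq, L2.inner_def,
      ← setIntegral_eq_integral_of_forall_compl_eq_zero (s := D) (f := fun x => ‖gradient φ x‖ ^ 2)]
    · refine integral_congr_ae ?_
      filter_upwards [h.memLp_gradient.coeFn_toLp] with x hx
      rw [hx, real_inner_self_eq_norm_sq]
    · intro x hx
      have : fderiv ℝ φ x = 0 := by
        have := fun hx' => hx (h.2.2 (support_fderiv_subset ℝ (f := φ) hx'))
        simpa using this
      simp [gradient, this]
  have := h.integral_sq_le hd hR
  rw [← hsq, ← hsq'] at this
  refine (sq_le_sq₀ (norm_nonneg _) (by positivity)).1 (this.trans_eq ?_)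
  ring

/-- The weak formulation of the Poisson problem, tested with all of `H¹₀(D)`. -/
theorem isPoissonSolution_iff {h y : L2 D} : IsPoissonSolution D h y ↔
    ∃ G, (h, y, G) ∈ weakSolutions (testPairs D).topologicalClosure := by
  refine exists_congr fun G => and_congr hasH10Gradient_iff ?_
  have key : ∀ (φ : Eucl d → ℝ) (hφ : IsTestFunction D φ),
      (∫ x in D, inner ℝ (G x) (gradient φ x) = ∫ x in D, h x * φ x) ↔
      inner ℝ G (hφ.memLp_gradient.toLp (gradient φ)) = inner ℝ h (hφ.memLp.toLp φ) := by
    intro φ hφ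
    rw [L2.inner_def, L2.inner_def]
    have h1 : ∫ x in D, inner ℝ (G x) (gradient φ x) =
        ∫ x in D, inner ℝ (G x) (hφ.memLp_gradient.toLp (gradient φ) x) :=
      integral_congr_ae (by
        filter_upwards [hφ.memLp_gradient.coeFn_toLp] with x hx
        rw [hx])
    have h2 : ∫ x in D, h x * φ x = ∫ x in D, inner ℝ (h x) (hφ.memLp.toLp φ x) :=
      integral_congr_ae (by
        filter_upwards [hφ.memLp.coeFn_toLp] with x hx
        rw [hx]
        simp [mul_comm])
    rw [h1, h2]
  constructor
  · intro hG w hw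
    have hcl : IsClosed {w : L2 D × Lp (Eucl d) 2 (volume.restrict D) |
        inner ℝ G w.2 = inner ℝ h w.1} := isClosed_eq (by fun_prop) (by fun_prop)
    refine closure_minimal ?_ hcl hw
    rintro _ ⟨φ, hφ, rfl⟩
    exact (key φ hφ).1 (hG φ hφ)
  · intro hG φ hφ
    exact (key φ hφ).2 (hG _ (subset_closure ⟨φ, hφ, rfl⟩))

end Poincare

section PointValue

variable {d : ℕ} {D : Set (Eucl d)}

theorem ball_subset_eventually (hD : IsOpen D) {x : Eucl d} (hx : x ∈ D) :
    ∀ᶠ r in 𝓝[>] (0 : ℝ), 0 < r ∧ Metric.ball x r ⊆ D := by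
  obtain ⟨δ, hδ, hb⟩ := Metric.isOpen_iff.1 hD x hx
  filter_upwards [Ioo_mem_nhdsGT hδ] with r hr
  exact ⟨hr.1, (Metric.ball_subset_ball hr.2.le).trans hb⟩

/-- **Lebesgue differentiation**: almost everywhere the point values are the values. -/
theorem ae_pointValue_eq (hD : IsOpen D) (hDb : Bornology.IsBounded D) (y : L2 D) :
    ∀ᵐ x ∂volume.restrict D, pointValue y x = (y x : EReal) := by
  have : IsFiniteMeasure (volume.restrict D) := ⟨by simpa using hDb.measure_lt_top⟩
  have hint : IntegrableOn y D := (Lp.memLp y).integrable (by norm_num)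
  have hloc : LocallyIntegrable (D.indicator y) :=
    (hint.integrable_indicator hD.measurableSet).locallyIntegrable
  rw [ae_restrict_iff' hD.measurableSet]
  filter_upwards [IsUnifLocDoublingMeasure.ae_tendsto_average volume hloc 1] with x hx hxD
  have hlim := hx (l := 𝓝[>] (0 : ℝ)) (fun _ => x) id tendsto_id (by
    filter_upwards [self_mem_nhdsWithin] with r hr
    exact Metric.mem_closedBall_self (by simpa using (mem_Ioi.1 hr).le))
  rw [indicator_of_mem hxD] at hlim
  have hlim' : Tendsto (fun r : ℝ => ⨍ t in Metric.ball x r, y t) (𝓝[>] 0) (𝓝 (y x)) := by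
    refine hlim.congr' ?_
    filter_upwards [ball_subset_eventually hD hxD] with r hr
    have hae : Metric.closedBall x r =ᵐ[volume] Metric.ball x r :=
      (ae_eq_of_subset_of_measure_ge Metric.ball_subset_closedBall
        (by rw [Measure.addHaar_closedBall _ _ hr.1.le, Measure.addHaar_ball_of_pos _ _ hr.1])
        measurableSet_ball.nullMeasurableSet Metric.isBounded_closedBall.measure_lt_top.ne).symm
    rw [id, setAverage_congr hae]
    refine setAverage_congr_fun measurableSet_ball (.of_forall fun t ht => ?_)
    exact indicator_of_mem (hr.2 ht) _
  exact ((continuous_coe_real_ereal.tendsto (y x)).comp hlim').limsup_eq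

theorem forall_pointValue_le_iff (hD : IsOpen D) (hDb : Bornology.IsBounded D) (y : L2 D)
    (α : ℝ) : (∀ x ∈ D, pointValue y x ≤ (α : EReal)) ↔ ∀ᵐ x ∂volume.restrict D, y x ≤ α := by
  have : IsFiniteMeasure (volume.restrict D) := ⟨by simpa using hDb.measure_lt_top⟩
  have hint : IntegrableOn y D := (Lp.memLp y).integrable (by norm_num)
  constructor
  · intro h
    filter_upwards [ae_pointValue_eq hD hDb y, ae_restrict_mem hD.measurableSet] with x hx hxD
    exact_mod_cast hx ▸ h x hxD
  · intro h x hx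
    refine limsup_le_of_le (by isBoundedDefault) ?_
    filter_upwards [ball_subset_eventually hD hx] with r hr
    have hmem := (convex_Iic α).set_average_mem (μ := volume) isClosed_Iic
      (Metric.measure_ball_pos volume x hr.1).ne' Metric.isBounded_ball.measure_lt_top.ne
      (ae_restrict_of_ae_restrict_of_subset hr.2 h) (hint.mono_set hr.2)
    exact_mod_cast hmem

end PointValue

section Admissible

variable {d m : ℕ}

/-- The right hand sides `h` for which the solution of `-Δ y = h`, `y = 0` on `∂D`, is at most `α`
in `D`. -/
def admissibleSources (D : Set (Eucl d)) (α : ℝ) : Set (L2 D) :=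
  {h | ∃ y ∈ {y : L2 D | ∀ᵐ x ∂volume.restrict D, y x ≤ α},
    ∃ G, (h, y, G) ∈ weakSolutions (testPairs D).topologicalClosure}

variable {D : Set (Eucl d)}

theorem stateBelow_iff (hD : IsOpen D) (hDb : Bornology.IsBounded D) {f₀ : L2 D}
    {φ : Fin m → L2 D} {α : ℝ} {u : L2 D} {z : Eucl m} :
    StateBelow D f₀ φ α u z ↔ u + source f₀ φ z ∈ admissibleSources D α :=
  exists_congr fun y => by
    rw [isPoissonSolution_iff, forall_pointValue_le_iff hD hDb, and_comm]
    rfl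

theorem isClosed_admissibleSources (hd : 1 ≤ d) (hDb : Bornology.IsBounded D) (α : ℝ) :
    IsClosed (admissibleSources D α) := by
  have : IsFiniteMeasure (volume.restrict D) := ⟨by simpa using hDb.measure_lt_top⟩
  obtain ⟨R, hR⟩ := hDb.subset_closedBall 0
  have hR' : D ⊆ Metric.closedBall 0 |R| :=
    hR.trans (Metric.closedBall_subset_closedBall (le_abs_self R))
  refine isClosed_rhs_weakSolutions (Submodule.isClosed_topologicalClosure _)
    (by positivity : 0 ≤ 2 * |R|)
    (fun w hw => norm_fst_le_of_mem_testPairs hd (abs_nonneg R) hR' hw) ?_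
  convert isClosed_Iic (a := (memLp_const α : MemLp _ 2 (volume.restrict D)).toLp fun _ => α)
  ext y
  rw [mem_Iic, ← Lp.coeFn_le]
  change (∀ᵐ x ∂volume.restrict D, y x ≤ α) ↔ _
  refine eventually_congr ?_
  filter_upwards [(memLp_const α : MemLp _ 2 (volume.restrict D)).coeFn_toLp] with x hx
  rw [hx]

theorem convex_admissibleSources (α : ℝ) : Convex ℝ (admissibleSources D α) := by
  refine convex_rhs_weakSolutions _ fun y hy y' hy' a b ha hb hab => ?_
  filter_upwards [hy, hy', Lp.coeFn_add (a • y) (b • y'), Lp.coeFn_smul a y, Lp.coeFn_smul b y']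
    with x h1 h2 h3 h4 h5
  rw [h3, Pi.add_apply, h4, h5]
  exact convex_Iic α h1 h2 ha hb hab

theorem continuous_source (f₀ : L2 D) (φ : Fin m → L2 D) : Continuous (source f₀ φ) := by
  unfold source
  fun_prop

variable {f₀ : L2 D} {φ : Fin m → L2 D} {α : ℝ}

theorem isClosed_setOf_stateBelow (hd : 1 ≤ d) (hD : IsOpen D) (hDb : Bornology.IsBounded D)
    (u : L2 D) : IsClosed {z | StateBelow D f₀ φ α u z} := by
  simp_rw [stateBelow_iff hD hDb]
  exact (isClosed_admissibleSources hd hDb α).preimage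
    (continuous_const.add (continuous_source f₀ φ))

theorem convex_setOf_stateBelow (hD : IsOpen D) (hDb : Bornology.IsBounded D) (z : Eucl m) :
    Convex ℝ {u | StateBelow D f₀ φ α u z} := by
  simp_rw [stateBelow_iff hD hDb]
  exact (convex_admissibleSources α).translate_preimage_left (source f₀ φ z)

theorem isClosed_setOf_stateBelow_control (hd : 1 ≤ d) (hD : IsOpen D)
    (hDb : Bornology.IsBounded D) (z : Eucl m) : IsClosed {u | StateBelow D f₀ φ α u z} := by
  simp_rw [stateBelow_iff hD hDb]
  exact (isClosed_admissibleSources hd hDb α).preimage (by fun_prop)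

variable {Ω : Type*} [MeasurableSpace Ω] {P : Measure Ω} {ξ : Ω → Eucl m}

theorem nullMeasurableSet_stateBelow (hd : 1 ≤ d) (hD : IsOpen D) (hDb : Bornology.IsBounded D)
    (hξ : AEMeasurable ξ P) (u : L2 D) :
    NullMeasurableSet {w | StateBelow D f₀ φ α u (ξ w)} P :=
  hξ.nullMeasurableSet_preimage (isClosed_setOf_stateBelow hd hD hDb u).measurableSet

variable [IsProbabilityMeasure P]

theorem isFeasible_one_iff (hd : 1 ≤ d) (hD : IsOpen D) (hDb : Bornology.IsBounded D)
    (hξ : AEMeasurable ξ P) {u : L2 D} :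
    IsFeasible D f₀ φ α P ξ 1 u ↔ ∀ᵐ w ∂P, StateBelow D f₀ φ α u (ξ w) := by
  have h1 := mem_ae_iff_prob_eq_one₀ (nullMeasurableSet_stateBelow (f₀ := f₀) (φ := φ) (α := α)
    hd hD hDb hξ u)
  refine Iff.trans ?_ h1.symm
  unfold IsFeasible
  rw [measureReal_def]
  constructor
  · intro h
    refine le_antisymm prob_le_one ?_
    rw [← ENNReal.ofReal_one]
    exact ENNReal.ofReal_le_of_le_toReal h
  · intro h
    simp [h]

theorem convex_setOf_isFeasible_one (hd : 1 ≤ d) (hD : IsOpen D) (hDb : Bornology.IsBounded D)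
    (hξ : AEMeasurable ξ P) : Convex ℝ {u | IsFeasible D f₀ φ α P ξ 1 u} := by
  intro u hu v hv a b ha hb hab
  rw [mem_ofPred_eq, isFeasible_one_iff hd hD hDb hξ] at hu hv ⊢
  filter_upwards [hu, hv] with w hu hv
  exact convex_setOf_stateBelow hD hDb (ξ w) hu hv ha hb hab

/-- If the probability levels tend to one fast enough, then almost surely the state constraint
holds eventually. -/
theorem ae_eventually_stateBelow (hd : 1 ≤ d) (hD : IsOpen D) (hDb : Bornology.IsBounded D)
    (hξ : AEMeasurable ξ P) {p : ℕ → ℝ} {u : ℕ → L2 D}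
    (hu : ∀ n, IsFeasible D f₀ φ α P ξ (p n) (u n)) (hp : ∀ n, 1 - p n ≤ (1 / 2) ^ n) :
    ∀ᵐ w ∂P, ∀ᶠ n in atTop, StateBelow D f₀ φ α (u n) (ξ w) := by
  have hle : ∀ n, P {w | StateBelow D f₀ φ α (u n) (ξ w)}ᶜ ≤ ENNReal.ofReal ((1 / 2) ^ n) := by
    intro n
    rw [← ofReal_measureReal, probReal_compl_eq_one_sub₀
      (nullMeasurableSet_stateBelow hd hD hDb hξ (u n))]
    have h1 : p n ≤ P.real {w | StateBelow D f₀ φ α (u n) (ξ w)} := hu n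
    exact ENNReal.ofReal_le_ofReal (by linarith [hp n])
  have hsum : ∑' n, P {w | StateBelow D f₀ φ α (u n) (ξ w)}ᶜ ≠ ⊤ := by
    refine ne_top_of_le_ne_top ?_ (ENNReal.tsum_le_tsum hle)
    rw [← ENNReal.ofReal_tsum_of_nonneg (fun n => by positivity) summable_geometric_two]
    exact ENNReal.ofReal_ne_top
  filter_upwards [ae_eventually_notMem hsum] with w hw
  filter_upwards [hw] with n hn
  simpa using hn

end Admissible

theorem mainTheorem4 {d m : ℕ} (hd1 : 1 ≤ d) (hd3 : d ≤ 3)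
    (D : Set (Eucl d)) (hDo : IsOpen D) (hDb : Bornology.IsBounded D) (hDS : IsClassS D)
    (f₀ : L2 D) (φ : Fin m → L2 D) (α : ℝ)
    (μ : Eucl m) (S : Matrix (Fin m) (Fin m) ℝ) (hS : S.PosSemidef)
    (Ξ : Set (Eucl m)) (hΞc : IsCompact Ξ) (hΞ : Convex ℝ Ξ)
    (hΞpos : 0 < multivariateGaussian μ S Ξ)
    {Ω : Type*} [MeasurableSpace Ω] (P : Measure Ω) [IsProbabilityMeasure P]
    (ξ : Ω → Eucl m) (hξ : HasLaw ξ (truncatedGaussian μ S Ξ) P)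
    (F : L2 D → ℝ) (hFd : Differentiable ℝ F) (hFc : StrictConvexOn ℝ Set.univ F)
    (p : ℕ → ℝ) (hp : ∀ k, p k ∈ Set.Ioo (0 : ℝ) 1) (hp1 : Tendsto p atTop (𝓝 1))
    (u : ℕ → L2 D) (hub : Bornology.IsBounded (Set.range u))
    (hu : ∀ k, IsOptimal D F f₀ φ α P ξ (p k) (u k)) :
    ∃ ubar : L2 D,
      IsOptimal D F f₀ φ α P ξ 1 ubar ∧
      (∀ v : L2 D, IsOptimal D F f₀ φ α P ξ 1 v → v = ubar) ∧
      Tendsto (fun k => toWeakSpace ℝ (L2 D) (u k)) atTop (𝓝 (toWeakSpace ℝ (L2 D) ubar)) ∧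
      ((∃ c : ℝ, 0 < c ∧ StrongConvexOn Set.univ c F) → Tendsto u atTop (𝓝 ubar)) := by
  have hξm : AEMeasurable ξ P := hξ.aemeasurable
  have hle : ∀ k v, IsFeasible D f₀ φ α P ξ 1 v → F (u k) ≤ F v := fun k v hv =>
    (hu k).2 v ((hp k).2.le.trans hv)
  have hlimit : ∀ (ns : ℕ → ℕ), (∀ n, 1 - p (ns n) ≤ (1 / 2) ^ n) →
      ∀ (U : Ultrafilter ℕ) (b : L2 D), ↑U ≤ (atTop : Filter ℕ) →
      Tendsto (fun n => toWeakSpace ℝ (L2 D) (u (ns n))) U (𝓝 (toWeakSpace ℝ (L2 D) b)) →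
      IsOptimal D F f₀ φ α P ξ 1 b := by
    intro ns hns U b hU hb
    refine ⟨?_, fun v hv => ?_⟩
    · rw [isFeasible_one_iff hd1 hDo hDb hξm]
      filter_upwards [ae_eventually_stateBelow hd1 hDo hDb hξm (fun n => (hu (ns n)).1) hns]
        with w hw
      exact (convex_setOf_stateBelow hDo hDb (ξ w)).mem_of_tendsto_toWeakSpace
        (isClosed_setOf_stateBelow_control hd1 hDo hDb (ξ w)) hb (hU hw)
    · have hlim := (tendsto_dual_of_tendsto_toWeakSpace hb (fderiv ℝ F b)).const_add
        (F b - fderiv ℝ F b b)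
      refine (le_of_tendsto hlim (.of_forall fun n => ?_)).trans' (by simp)
      have h1 := (uniformConvexOn_zero.2 hFc.convexOn).add_fderiv_add_le
        (hFd b).hasFDerivAt (u (ns n))
      rw [map_sub, Pi.zero_apply] at h1
      linarith [hle (ns n) v hv]
  have hfast : ∀ ns : ℕ → ℕ, Tendsto ns atTop atTop →
      ∃ ms : ℕ → ℕ, ∀ n, 1 - p (ns (ms n)) ≤ (1 / 2) ^ n := by
    intro ns hns
    have h1 : Tendsto (fun n => 1 - p (ns n)) atTop (𝓝 0) := by
      simpa using (hp1.comp hns).const_sub 1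
    exact ⟨_, fun n => (h1.eventually (ge_mem_nhds (by positivity :
      (0 : ℝ) < (1 / 2) ^ n))).exists.choose_spec⟩
  have hsub : ∀ ns : ℕ → ℕ, Bornology.IsBounded (range fun n => u (ns n)) := fun ns =>
    hub.subset (range_comp_subset_range ns u)
  obtain ⟨ms, hms⟩ := hfast id tendsto_id
  obtain ⟨ubar, hubar⟩ := exists_tendsto_toWeakSpace_ultrafilter (hsub ms) (hyperfilter ℕ)
  have hopt := hlimit ms hms _ ubar Nat.hyperfilter_le_atTop hubar
  have huniq : ∀ v : L2 D, IsOptimal D F f₀ φ α P ξ 1 v → v = ubar := fun v hv =>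
    (hFc.subset (subset_univ _) (convex_setOf_isFeasible_one hd1 hDo hDb hξm)).eq_of_isMinOn
      (fun x hx => hv.2 x hx) (fun x hx => hopt.2 x hx) hv.1 hopt.1
  have hweak : Tendsto (fun k => toWeakSpace ℝ (L2 D) (u k)) atTop
      (𝓝 (toWeakSpace ℝ (L2 D) ubar)) := by
    refine tendsto_toWeakSpace_of_subseq hub fun ns hns => ?_
    obtain ⟨ms, hms⟩ := hfast ns hns
    exact ⟨ms, fun U b hU hb => huniq b (hlimit (ns ∘ ms) hms U b hU hb)⟩
  refine ⟨ubar, hopt, huniq, hweak, ?_⟩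
  rintro ⟨c, hc, hFs⟩
  have hlim : Tendsto (fun k => 2 / c * (fderiv ℝ F ubar ubar - fderiv ℝ F ubar (u k))) atTop
      (𝓝 0) := by
    simpa using ((tendsto_dual_of_tendsto_toWeakSpace hweak
      (fderiv ℝ F ubar)).const_sub (fderiv ℝ F ubar ubar)).const_mul (2 / c)
  have hsq : Tendsto (fun k => ‖u k - ubar‖ ^ 2) atTop (𝓝 0) := by
    refine squeeze_zero (fun k => by positivity) (fun k => ?_) hlim
    have h1 := UniformConvexOn.add_fderiv_add_le hFs (hFd ubar).hasFDerivAt (u k)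
    rw [map_sub, norm_sub_rev] at h1
    have h2 := hle k ubar hopt.1
    have h3 : c / 2 * ‖u k - ubar‖ ^ 2 ≤ fderiv ℝ F ubar ubar - fderiv ℝ F ubar (u k) := by
      linarith
    calc ‖u k - ubar‖ ^ 2 = 2 / c * (c / 2 * ‖u k - ubar‖ ^ 2) := by field_simp
      _ ≤ _ := by gcongr
  rw [tendsto_iff_norm_sub_tendsto_zero]
  simpa using hsq.sqrt
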